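/- Black-box setting. Let $R_0>0$, let $\mathcal H=\mathcal H_{R_0}\oplus L^2(\mathbb R^n\setminus B(0,R_0))$ be an orthogonal sum of complex Hilbert spaces, and let $P$ be a self-adjoint operator on $\mathcal H$ with domain $\mathcal D$ such that, for $u\in\mathcal D$, the component of $u$ in $L^2(\mathbb R^n\setminus B(0,R_0))$ lies in $H^2(\mathbb R^n\setminus B(0,R_0))$ and $Pu=-\Delta u$ in $\mathbb R^n\setminus B(0,R_0)$; every $v\in H^2(\mathbb R^n)$ vanishing on $B(0,R_0+\varepsilon)$ for some $\varepsilon>0$ belongs to $\mathcal D$; and $\mathbf 1_{B(0,R_0)}(P+\mathrm i)^{-1}$ is compact. A function $\chi\in C_c^\infty(\mathbb R^n)$ equal to $1$ near $\overline{B(0,R_0)}$ acts on $\mathcal H$ as the identity on $\mathcal H_{R_0}$ and as multiplication by $\chi$ on $L^2(\mathbb R^n\setminus B(0,R_0))$. For $k>0$, $\chi R(k)\chi$ denotes the value at $k$ of the meromorphic continuation to $\{\operatorname{Re}z>0\}$ of $z\mapsto\chi(P-z^2)^{-1}\chi$, $\operatorname{Re}z>0$, $\operatorname{Im}z>0$;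 at a pole we put $\|\chi R(k)\chi\|_{\mathcal H\to\mathcal H}=\infty$. Lemma (lower bound on the resolvent when quasimodes are equidistributed). Let $K\subset\mathbb R^n$ be compact and $s\ge 0$, and suppose that there are constants $C_0,C_1>0$ such that for all $k>0$ and all $\lambda\in[k,k+1]$ there exist a real $\mu>0$ with $|\mu-\lambda|<C_1k^{-s}$ and a $\mu$-quasimode for $P$ of order $s-1$ supported in $K$, that is, $u\in\mathcal D$ with $\|u\|_{\mathcal H}=1$, the component of $u$ in $L^2(\mathbb R^n\setminus B(0,R_0))$ vanishing almost everywhere outside $K$, and $$\|(P-\mu^2)u\|_{\mathcal H}\le C_0\,\mu^{-(s-1)} .$$ Then there exists $\chi\in C_c^\infty(\mathbb R^n)$, equal to $1$ near $\overline{B(0,R_0)}$, such that: (a) for every $k_0>0$ there exists $C_2>0$ such that $$\|\chi R(k)\chi\|_{\mathcal H\to\mathcal H}\ge C_2\,k^{s-1}\qquad\text{for all }k\ge k_0;$$ (b) if $s\ge1$, there exists $C_2>0$ such that this bound holds for all $k>0$. -/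

import Mathlib

open MeasureTheory Filter Topology Set
open scoped ContDiff ENNReal Laplacian

noncomputable section

namespace BlackBoxScattering

/-- `ℝⁿ` with its Euclidean norm. -/
abbrev Rn (n : ℕ) : Type := EuclideanSpace ℝ (Fin n)

/-! ### Sobolev spaces on open sets, through weak derivatives -/

/-- Real-valued test functions on the open set `Ω`. -/
structure IsTest {n : ℕ} (Ω : Set (Rn n)) (φ : Rn n → ℝ) : Prop where
  smooth : ContDiff ℝ ∞ φ
  compact : HasCompactSupport φ
  supp : tsupport φ ⊆ Ω

/-- `w` is the weak partial derivative `∂ᵢ v` on the open set `Ω`. -/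
def IsWeakPartial {n : ℕ} (Ω : Set (Rn n)) (i : Fin n) (v w : Rn n → ℂ) : Prop :=
  ∀ φ : Rn n → ℝ, IsTest Ω φ →
    ∫ x in Ω, (fderiv ℝ φ x (EuclideanSpace.single i 1)) • v x = - ∫ x in Ω, φ x • w x

/-- `w` is the distributional Laplacian of `v` on the open set `Ω`. -/
def IsWeakLaplacian {n : ℕ} (Ω : Set (Rn n)) (v w : Rn n → ℂ) : Prop :=
  ∀ φ : Rn n → ℝ, IsTest Ω φ → ∫ x in Ω, (Δ φ) x • v x = ∫ x in Ω, φ x • w x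

/-- Membership in the Sobolev space `H²(Ω)`, for `Ω` open: the function and its weak partial
derivatives of order one and two are square integrable. -/
def MemH2 {n : ℕ} (Ω : Set (Rn n)) (v : Rn n → ℂ) : Prop :=
  MemLp v 2 (volume.restrict Ω) ∧
    ∃ (g : Fin n → Rn n → ℂ) (h : Fin n → Fin n → Rn n → ℂ),
      (∀ i, MemLp (g i) 2 (volume.restrict Ω) ∧ IsWeakPartial Ω i v (g i)) ∧
      ∀ i j, MemLp (h i j) 2 (volume.restrict Ω) ∧ IsWeakPartial Ω j (g i) (h i j)

/-! ### Resolvents of unbounded operators -/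

/-- The bounded operator `T` is the resolvent `(P - w)⁻¹` of the unbounded operator `P`. -/
def IsResolventAt {H : Type*} [NormedAddCommGroup H] [NormedSpace ℂ H]
    (P : H →ₗ.[ℂ] H) (w : ℂ) (T : H →L[ℂ] H) : Prop :=
  (∀ f : H, ∃ h : T f ∈ P.domain, P ⟨T f, h⟩ - w • T f = f) ∧
    ∀ u : P.domain, T (P u - w • (u : H)) = u

open Classical in
/-- The resolvent `(P - w)⁻¹` as a bounded operator (zero if `w` lies in the spectrum of `P`). -/
def resolvent {H : Type*} [NormedAddCommGroup H] [NormedSpace ℂ H]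
    (P : H →ₗ.[ℂ] H) (w : ℂ) : H →L[ℂ] H :=
  if h : ∃ T, IsResolventAt P w T then h.choose else 0

/-! ### Black box Hamiltonians -/

/-- The part `L²(ℝⁿ ∖ B(0,R₀))` of the black box Hilbert space. -/
abbrev ExteriorL2 (n : ℕ) (R₀ : ℝ) : Type :=
  Lp ℂ 2 ((volume : Measure (Rn n)).restrict (Metric.ball 0 R₀)ᶜ)

/-- The black box Hilbert space `ℋ = ℋ_{R₀} ⊕ L²(ℝⁿ ∖ B(0,R₀))` (orthogonal direct sum). The
components of `u` are `u.fst` and `u.snd`. -/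
abbrev Space (n : ℕ) (R₀ : ℝ) (H₀ : Type*) [NormedAddCommGroup H₀] [InnerProductSpace ℂ H₀] :
    Type _ :=
  WithLp 2 (H₀ × ExteriorL2 n R₀)

/-- The open set `{x : |x| > R₀}`, the interior of `ℝⁿ ∖ B(0,R₀)`. -/
def exterior (n : ℕ) (R₀ : ℝ) : Set (Rn n) := {x | R₀ < ‖x‖}

/-- A black box Hamiltonian: a self-adjoint operator `P` on `ℋ_{R₀} ⊕ L²(ℝⁿ ∖ B(0,R₀))` which is
`-Δ` outside `B(0,R₀)` and for which `1_{B(0,R₀)} (P + i)⁻¹` is compact. -/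
structure BlackBox (n : ℕ) (R₀ : ℝ) (H₀ : Type*) [NormedAddCommGroup H₀]
    [InnerProductSpace ℂ H₀] [CompleteSpace H₀] where
  radius_pos : 0 < R₀
  /-- The operator, with its domain `P.domain`. -/
  P : Space n R₀ H₀ →ₗ.[ℂ] Space n R₀ H₀
  selfAdjoint : IsSelfAdjoint P
  /-- The restriction of the domain to the exterior lies in `H²`. -/
  exterior_memH2 : ∀ u : P.domain, MemH2 (exterior n R₀) (u : Space n R₀ H₀).snd
  /-- `P u = -Δ u` in the exterior. -/
  exterior_eq : ∀ u : P.domain,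
    IsWeakLaplacian (exterior n R₀) (u : Space n R₀ H₀).snd (fun x => -(P u).snd x)
  /-- Functions in `H²(ℝⁿ)` vanishing on some `B(0, R₀ + ε)` belong to the domain. -/
  mem_domain : ∀ (v : Rn n → ℂ) (ε : ℝ), MemH2 univ v → 0 < ε →
    (∀ᵐ x ∂(volume : Measure (Rn n)), x ∈ Metric.ball 0 (R₀ + ε) → v x = 0) →
    ∀ u : Space n R₀ H₀, u.fst = 0 →
      u.snd =ᵐ[volume.restrict (Metric.ball 0 R₀)ᶜ] v → u ∈ P.domain
  /-- `1_{B(0,R₀)} (P + i)⁻¹` is compact. -/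
  compact_resolvent : IsCompactOperator
    (fun f : Space n R₀ H₀ => (resolvent P (-Complex.I) f).fst)

/-! ### Cutoff functions and their action on `ℋ` -/

/-- A function `χ ∈ C_c^∞(ℝⁿ)` which equals `1` near the closed ball of radius `R₀`. -/
structure Cutoff (n : ℕ) (R₀ : ℝ) where
  toFun : Rn n → ℝ
  smooth : ContDiff ℝ ∞ toFun
  compact : HasCompactSupport toFun
  eq_one : ∀ᶠ x in 𝓝ˢ (Metric.closedBall (0 : Rn n) R₀), toFun x = 1

namespace Cutoff

variable {n : ℕ} {R₀ : ℝ}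

theorem memLp_top (χ : Cutoff n R₀) :
    MemLp (fun x => (χ.toFun x : ℂ)) ∞
      ((volume : Measure (Rn n)).restrict (Metric.ball 0 R₀)ᶜ) :=
  (Complex.continuous_ofReal.comp χ.smooth.continuous).memLp_top_of_hasCompactSupport
    (χ.compact.comp_left Complex.ofReal_zero) _

/-- Multiplication by `χ` on `L²(ℝⁿ ∖ B(0,R₀))`. -/
def mulExterior (χ : Cutoff n R₀) : ExteriorL2 n R₀ →L[ℂ] ExteriorL2 n R₀ :=
  (ContinuousLinearMap.mul ℂ ℂ).holderL _ ∞ 2 2 χ.memLp_top.toLp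

theorem coeFn_mulExterior (χ : Cutoff n R₀) (v : ExteriorL2 n R₀) :
    χ.mulExterior v =ᵐ[volume.restrict (Metric.ball 0 R₀)ᶜ] fun x => (χ.toFun x : ℂ) * v x := by
  have h := (ContinuousLinearMap.mul ℂ ℂ).coeFn_holder (r := 2) (χ.memLp_top.toLp) v
  filter_upwards [h, χ.memLp_top.coeFn_toLp] with x h1 h2
  refine Eq.trans h1 ?_
  rw [h2]
  rfl

/-- Multiplication by `χ` on `ℋ`: the identity on `ℋ_{R₀}` (where `χ = 1`) and multiplication
by `χ` on `L²(ℝⁿ ∖ B(0,R₀))`. -/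
def mul (χ : Cutoff n R₀) (H₀ : Type*) [NormedAddCommGroup H₀] [InnerProductSpace ℂ H₀] :
    Space n R₀ H₀ →L[ℂ] Space n R₀ H₀ :=
  ((WithLp.prodContinuousLinearEquiv 2 ℂ H₀ (ExteriorL2 n R₀)).symm :
      (H₀ × ExteriorL2 n R₀) →L[ℂ] Space n R₀ H₀) ∘L
    (ContinuousLinearMap.id ℂ H₀).prodMap χ.mulExterior ∘L
    ((WithLp.prodContinuousLinearEquiv 2 ℂ H₀ (ExteriorL2 n R₀)) :
      Space n R₀ H₀ →L[ℂ] H₀ × ExteriorL2 n R₀)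

end Cutoff

/-! ### The cut-off resolvent and quasimodes -/

/-- The norm at `k` of a meromorphic family `F` of operators: `∞` at a pole, and otherwise the norm
of the value of `F` at `k` after removal of a removable singularity. -/
def meromorphicNorm {E : Type*} [NormedAddCommGroup E] [NormedSpace ℂ E] (F : ℂ → E) (k : ℂ) :
    ℝ≥0∞ :=
  if meromorphicOrderAt F k < 0 then ∞ else ‖toMeromorphicNFAt F k k‖ₑ

namespace BlackBox

variable {n : ℕ} {R₀ : ℝ} {H₀ : Type*} [NormedAddCommGroup H₀] [InnerProductSpace ℂ H₀]
  [CompleteSpace H₀]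

/-- `χ R(z) χ = χ (P - z²)⁻¹ χ`, to be used for `Re z > 0`, `Im z > 0`. -/
def cutoffResolvent (B : BlackBox n R₀ H₀) (χ : Cutoff n R₀) (z : ℂ) :
    Space n R₀ H₀ →L[ℂ] Space n R₀ H₀ :=
  χ.mul H₀ ∘L resolvent B.P (z ^ 2) ∘L χ.mul H₀

/-- `F` is the outgoing cut-off resolvent `k ↦ χ R(k) χ`: the meromorphic continuation of
`z ↦ χ (P - z²)⁻¹ χ` from the quadrant `Re z > 0`, `Im z > 0` to the half plane `Re z > 0`. -/
def IsOutgoingCutoffResolvent (B : BlackBox n R₀ H₀) (χ : Cutoff n R₀)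
    (F : ℂ → Space n R₀ H₀ →L[ℂ] Space n R₀ H₀) : Prop :=
  MeromorphicOn F {z | 0 < z.re} ∧
    ∀ z : ℂ, 0 < z.re → 0 < z.im → F z = B.cutoffResolvent χ z

open Classical in
/-- The norm `‖χ R(k) χ‖` of the outgoing cut-off resolvent at `k > 0`, with the value `∞` when `k`
is a pole. The continuation exists for every black box Hamiltonian and is unique up to its values on
a discrete set, to which `meromorphicNorm` is insensitive. The second branch is thus never used; it
is the boundary value from the upper half plane, which agrees with the first branch. -/
def cutoffResolventNorm (B : BlackBox n R₀ H₀) (χ : Cutoff n R₀) (k : ℝ) : ℝ≥0∞ :=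
  if h : ∃ F, B.IsOutgoingCutoffResolvent χ F then meromorphicNorm h.choose (k : ℂ)
  else liminf (fun z => ‖B.cutoffResolvent χ z‖ₑ) (𝓝[{z : ℂ | 0 < z.im}] (k : ℂ))

/-- There is a normalised `u` in the domain of `P`, supported in `K`, with
`‖(P - μ²) u‖ ≤ δ`. The component of `u` in `ℋ_{R₀}` is regarded as supported in `B(0,R₀)`, and
`K` is only tested outside this ball. -/
def HasQuasimode (B : BlackBox n R₀ H₀) (K : Set (Rn n)) (μ δ : ℝ) : Prop :=
  ∃ u : B.P.domain, ‖(u : Space n R₀ H₀)‖ = 1 ∧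
    (∀ᵐ x ∂(volume : Measure (Rn n)).restrict (Metric.ball 0 R₀)ᶜ,
      x ∉ K → (u : Space n R₀ H₀).snd x = 0) ∧
    ‖B.P u - ((μ : ℂ) ^ 2) • (u : Space n R₀ H₀)‖ ≤ δ

end BlackBox

end BlackBoxScattering

end

/-!
The cut-off `χ` is taken equal to `1` on a large ball that contains `K` and the black box. If `u` is
in the domain of `P` and supported in `K`, then so is `P u`, because `P` is the distributional
Laplacian (up to sign) outside the black box and hence local
(`BlackBoxScattering.BlackBox.apply_snd_ae_eq_zero`). Multiplication by `χ` therefore fixes both `u`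
and `(P - z²) u`, so that `u = χ R(z) χ (P - z²) u` for `z` in the open first quadrant, where the
resolvent exists by self-adjointness (`BlackBoxScattering.exists_isResolventAt`). Letting `z` tend
to `k > 0` gives `‖χ R(k) χ‖ ≥ 1 / ‖(P - k²) u‖` for normalised `u`
(`BlackBoxScattering.BlackBox.inv_le_cutoffResolventNorm`).

For large `k`, this is applied to a quasimode with `μ` near `k`: both
`‖(P - μ²) u‖` and `|μ² - k²| ≤ |μ - k| (μ + k)` are `O(k ^ (1 - s))`. For bounded `k`, any fixed
element of the domain supported in `K` gives a uniform positive lower bound, and `k ^ (s - 1)` is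
bounded above there: on `[k₀, k₁]` for every `s`, and on `(0, k₁]` if `s ≥ 1`.
-/

open MeasureTheory Filter Topology Set
open scoped ContDiff ENNReal Laplacian

namespace BlackBoxScattering

/-! ### Resolvents of self-adjoint operators -/

section Resolvent

variable {H : Type*} [NormedAddCommGroup H] [InnerProductSpace ℂ H]

/-- The map `u ↦ P u - w u` on the domain of `P`. -/
def subSmul (P : H →ₗ.[ℂ] H) (w : ℂ) : P.domain →ₗ[ℂ] H :=
  P.toFun - w • P.domain.subtype

theorem subSmul_apply (P : H →ₗ.[ℂ] H) (w : ℂ) (u : P.domain) :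
    subSmul P w u = P u - w • (u : H) := rfl

variable [CompleteSpace H]

theorem abs_im_mul_norm_le {P : H →ₗ.[ℂ] H} (hP : IsSelfAdjoint P) (w : ℂ) (u : P.domain) :
    |w.im| * ‖(u : H)‖ ≤ ‖P u - w • (u : H)‖ := by
  have hsym : inner ℂ (P u) (u : H) = inner ℂ (u : H) (P u) := by
    have h := LinearPMap.adjoint_isFormalAdjoint hP.dense_domain
    rw [LinearPMap.isSelfAdjoint_def.1 hP] at h
    exact h u u
  have him : (inner ℂ (u : H) (P u)).im = 0 := by
    rw [← Complex.conj_eq_iff_im]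
    exact (inner_conj_symm _ _).trans hsym
  have h1 : (inner ℂ (u : H) (P u - w • (u : H))).im = -(w.im * ‖(u : H)‖ ^ 2) := by
    rw [inner_sub_right, inner_smul_right, inner_self_eq_norm_sq_to_K, Complex.sub_im, him]
    have : ((‖(u : H)‖ : ℂ) ^ 2) = ((‖(u : H)‖ ^ 2 : ℝ) : ℂ) := by push_cast; rfl
    change 0 - (w * (‖(u : H)‖ : ℂ) ^ 2).im = _
    rw [this, Complex.im_mul_ofReal]
    ring
  have h2 : |w.im| * ‖(u : H)‖ ^ 2 ≤ ‖(u : H)‖ * ‖P u - w • (u : H)‖ := by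
    calc |w.im| * ‖(u : H)‖ ^ 2 = |(inner ℂ (u : H) (P u - w • (u : H))).im| := by
          rw [h1, abs_neg, abs_mul, abs_of_nonneg (sq_nonneg ‖(u : H)‖)]
      _ ≤ ‖inner ℂ (u : H) (P u - w • (u : H))‖ := Complex.abs_im_le_norm _
      _ ≤ _ := norm_inner_le_norm _ _
  rcases (norm_nonneg (u : H)).eq_or_lt with h0 | h0
  · rw [← h0, mul_zero]
    exact norm_nonneg _
  · refine le_of_mul_le_mul_left ?_ h0
    linarith [h2]

theorem subSmul_injective {P : H →ₗ.[ℂ] H} (hP : IsSelfAdjoint P) {w : ℂ} (hw : w.im ≠ 0) :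
    Function.Injective (subSmul P w) := by
  rw [injective_iff_map_eq_zero]
  intro u hu
  have h := abs_im_mul_norm_le hP w u
  rw [← subSmul_apply, hu, norm_zero] at h
  have : ‖(u : H)‖ = 0 :=
    le_antisymm (nonpos_of_mul_nonpos_right h (abs_pos.2 hw)) (norm_nonneg _)
  exact Subtype.ext (norm_eq_zero.1 this)

/-- The range of `P - w` is closed, because `P` is closed and `P - w` is bounded below. -/
theorem isClosed_range_subSmul {P : H →ₗ.[ℂ] H} (hP : IsSelfAdjoint P) {w : ℂ} (hw : w.im ≠ 0) :
    IsClosed (LinearMap.range (subSmul P w) : Set H) := by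
  have hpos : 0 < |w.im| := abs_pos.2 hw
  refine IsSeqClosed.isClosed fun f g hf hg => ?_
  choose u hu using hf
  have hCauchy : CauchySeq fun m => (u m : H) := by
    rw [Metric.cauchySeq_iff']
    intro ε hε
    obtain ⟨N, hN⟩ := Metric.cauchySeq_iff'.1 hg.cauchySeq (|w.im| * ε) (mul_pos hpos hε)
    refine ⟨N, fun m hm => ?_⟩
    have h1 := abs_im_mul_norm_le hP w (u m - u N)
    rw [← subSmul_apply, map_sub, hu, hu] at h1
    have h2 := hN m hm
    rw [dist_eq_norm] at h2 ⊢
    exact lt_of_mul_lt_mul_left (h1.trans_lt h2) hpos.le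
  obtain ⟨v, hv⟩ := cauchySeq_tendsto_of_complete hCauchy
  have hPu : Tendsto (fun m => P (u m)) atTop (𝓝 (g + w • v)) := by
    refine (hg.add (hv.const_smul w)).congr fun m => ?_
    rw [← hu m, subSmul_apply, sub_add_cancel]
  have hgraph : (v, g + w • v) ∈ P.graph :=
    hP.isClosed.mem_of_tendsto (hv.prodMk_nhds hPu)
      (Eventually.of_forall fun m => P.mem_graph (u m))
  obtain ⟨y, hy1, hy2⟩ := (LinearPMap.mem_graph_iff P).1 hgraph
  refine ⟨y, ?_⟩
  simp only at hy1 hy2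
  rw [subSmul_apply, hy2, hy1, add_sub_cancel_right]

/-- A vector orthogonal to the range of `P - w` is an eigenvector of `P† = P` for the nonreal
eigenvalue `conj w`, hence zero. -/
theorem orthogonal_range_subSmul {P : H →ₗ.[ℂ] H} (hP : IsSelfAdjoint P) {w : ℂ}
    (hw : w.im ≠ 0) : (LinearMap.range (subSmul P w))ᗮ = ⊥ := by
  rw [Submodule.eq_bot_iff]
  intro x hx
  have hx' : ∀ y : P.domain, inner ℂ (starRingEnd ℂ w • x) (y : H) = inner ℂ x (P y) := by
    intro y
    have h := (Submodule.mem_orthogonal' _ _).1 hx _ ⟨y, rfl⟩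
    rw [subSmul_apply, inner_sub_right, inner_smul_right, sub_eq_zero] at h
    rw [inner_smul_left, Complex.conj_conj, h]
  have hadj := LinearPMap.isSelfAdjoint_def.1 hP
  have hmem : ∃ h : x ∈ P.domain, P ⟨x, h⟩ = starRingEnd ℂ w • x := by
    rw [← hadj]
    have h : x ∈ P.adjoint.domain := LinearPMap.mem_adjoint_domain_of_exists x ⟨_, hx'⟩
    exact ⟨h, LinearPMap.adjoint_apply_eq hP.dense_domain ⟨x, h⟩ hx'⟩
  obtain ⟨h, hPx⟩ := hmem
  have hconj : (starRingEnd ℂ w).im ≠ 0 := by simpa using hw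
  have h0 : subSmul P (starRingEnd ℂ w) ⟨x, h⟩ = 0 := by
    rw [subSmul_apply, hPx, sub_self]
  exact congrArg Subtype.val ((injective_iff_map_eq_zero _).1 (subSmul_injective hP hconj) _ h0)

theorem exists_isResolventAt {P : H →ₗ.[ℂ] H} (hP : IsSelfAdjoint P) {w : ℂ} (hw : w.im ≠ 0) :
    ∃ T, IsResolventAt P w T := by
  have hsurj : LinearMap.range (subSmul P w) = ⊤ := by
    have hc := isClosed_range_subSmul hP hw
    have : CompleteSpace (LinearMap.range (subSmul P w)) := hc.completeSpace_coe
    exact (Submodule.orthogonal_eq_bot_iff).1 (orthogonal_range_subSmul hP hw)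
  let e : P.domain ≃ₗ[ℂ] H :=
    LinearEquiv.ofBijective (subSmul P w) ⟨subSmul_injective hP hw, LinearMap.range_eq_top.1 hsurj⟩
  have he : ∀ u : P.domain, e u = P u - w • (u : H) := fun u => rfl
  let T : H →L[ℂ] H := LinearMap.mkContinuous (P.domain.subtype ∘ₗ e.symm.toLinearMap) |w.im|⁻¹ <| by
    intro f
    have h := abs_im_mul_norm_le hP w (e.symm f)
    rw [← he, e.apply_symm_apply] at h
    rw [inv_mul_eq_div, le_div_iff₀' (abs_pos.2 hw)]
    exact h
  refine ⟨T, fun f => ⟨(e.symm f).2, e.apply_symm_apply f⟩, fun u => ?_⟩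
  rw [← he]
  exact congrArg Subtype.val (e.symm_apply_apply u)

theorem resolvent_apply_sub {P : H →ₗ.[ℂ] H} (hP : IsSelfAdjoint P) {w : ℂ} (hw : w.im ≠ 0)
    (u : P.domain) : resolvent P w (P u - w • (u : H)) = u := by
  have h := exists_isResolventAt hP hw
  rw [resolvent, dif_pos h]
  exact h.choose_spec.2 u

end Resolvent

/-! ### Locality of the operator and cut-offs -/

theorem isOpen_exterior (n : ℕ) (R₀ : ℝ) : IsOpen (exterior n R₀) :=
  isOpen_lt continuous_const continuous_norm

theorem exterior_subset_compl_ball (n : ℕ) (R₀ : ℝ) :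
    exterior n R₀ ⊆ (Metric.ball (0 : Rn n) R₀)ᶜ := by
  intro x hx
  simpa using le_of_lt hx

/-- The exterior component `v` vanishes almost everywhere outside `K`. -/
def ExteriorSupportedIn {n : ℕ} {R₀ : ℝ} (K : Set (Rn n)) (v : ExteriorL2 n R₀) : Prop :=
  ∀ᵐ x ∂(volume : Measure (Rn n)).restrict (Metric.ball 0 R₀)ᶜ, x ∉ K → v x = 0

theorem laplacian_eq_zero_of_notMem_tsupport {n : ℕ} {φ : Rn n → ℝ} {x : Rn n}
    (hx : x ∉ tsupport φ) : (Δ φ) x = 0 := by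
  have h : φ =ᶠ[𝓝 x] 0 := notMem_tsupport_iff_eventuallyEq.1 hx
  rw [(InnerProductSpace.laplacian_congr_nhds h).eq_of_nhds]
  simp [InnerProductSpace.laplacian_eq_iteratedFDeriv_stdOrthonormalBasis]

namespace BlackBox

variable {n : ℕ} {R₀ : ℝ} {H₀ : Type*} [NormedAddCommGroup H₀] [InnerProductSpace ℂ H₀]
  [CompleteSpace H₀]

/-- Locality: `P u` vanishes wherever `u` does, on open subsets of the exterior. -/
theorem apply_snd_ae_eq_zero (B : BlackBox n R₀ H₀) {K : Set (Rn n)} (hK : IsClosed K)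
    (u : B.P.domain) (hu : ExteriorSupportedIn K (u : Space n R₀ H₀).snd) :
    ∀ᵐ x ∂(volume : Measure (Rn n)), x ∈ exterior n R₀ ∩ Kᶜ → (B.P u).snd x = 0 := by
  have hU : IsOpen (exterior n R₀ ∩ Kᶜ) := (isOpen_exterior n R₀).inter hK.isOpen_compl
  have hloc : LocallyIntegrableOn ((B.P u).snd : Rn n → ℂ) (exterior n R₀ ∩ Kᶜ) volume :=
    (locallyIntegrableOn_of_locallyIntegrable_restrict
      ((Lp.memLp (B.P u).snd).locallyIntegrable one_le_two)).mono_set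
      (inter_subset_left.trans (exterior_subset_compl_ball n R₀))
  refine hU.ae_eq_zero_of_integral_contDiff_smul_eq_zero hloc fun φ hφ hφc hφs => ?_
  have htest : IsTest (exterior n R₀) φ := ⟨hφ, hφc, hφs.trans inter_subset_left⟩
  have h := B.exterior_eq u φ htest
  have hleft : ∫ x in exterior n R₀, (Δ φ) x • (u : Space n R₀ H₀).snd x = 0 := by
    refine integral_eq_zero_of_ae ?_
    have hu' := ae_restrict_of_ae_restrict_of_subset (exterior_subset_compl_ball n R₀) hu
    filter_upwards [hu'] with x hx
    by_cases hxs : x ∈ tsupport φ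
    · rw [hx (hφs hxs).2, smul_zero]
      rfl
    · rw [laplacian_eq_zero_of_notMem_tsupport hxs, zero_smul]
      rfl
  rw [hleft] at h
  have hright : ∫ x in exterior n R₀, φ x • (B.P u).snd x = 0 := by
    simpa [integral_neg] using h.symm
  rw [← hright]
  refine (setIntegral_eq_integral_of_forall_compl_eq_zero fun x hx => ?_).symm
  have : x ∉ tsupport φ := fun hxs => hx (hφs hxs).1
  rw [image_eq_zero_of_notMem_tsupport this, zero_smul]

end BlackBox

namespace Cutoff

variable {n : ℕ} {R₀ : ℝ} {H₀ : Type*} [NormedAddCommGroup H₀] [InnerProductSpace ℂ H₀]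

theorem mul_eq_self (χ : Cutoff n R₀) {f : Space n R₀ H₀}
    (hf : ∀ᵐ x ∂(volume : Measure (Rn n)).restrict (Metric.ball 0 R₀)ᶜ,
      χ.toFun x ≠ 1 → f.snd x = 0) : χ.mul H₀ f = f := by
  have h : χ.mulExterior f.snd = f.snd := by
    refine Lp.ext ?_
    filter_upwards [χ.coeFn_mulExterior f.snd, hf] with x h1 h2
    rw [h1]
    by_cases hx : χ.toFun x = 1
    · rw [hx, Complex.ofReal_one, one_mul]
    · rw [h2 hx, mul_zero]
  change WithLp.toLp 2 (f.fst, χ.mulExterior f.snd) = f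
  rw [h]
  rfl

theorem exists_eq_one_on (R₀ : ℝ) {K : Set (Rn n)} (hK : IsCompact K) :
    ∃ χ : Cutoff n R₀, ∀ x ∈ K, χ.toFun x = 1 := by
  obtain ⟨r, hr⟩ := hK.isBounded.subset_closedBall (0 : Rn n)
  set ρ : ℝ := max (max r (R₀ + 1)) 1 with hρ
  have hρ0 : 0 < ρ := lt_of_lt_of_le one_pos (le_max_right _ _)
  have hrρ : r ≤ ρ := (le_max_left _ _).trans (le_max_left _ _)
  have hRρ : R₀ < ρ :=
    lt_of_lt_of_le (lt_add_one _) ((le_max_right _ _).trans (le_max_left _ _))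
  let b : ContDiffBump (0 : Rn n) := ⟨ρ, ρ + 1, hρ0, lt_add_one _⟩
  refine ⟨⟨b, b.contDiff, b.hasCompactSupport, ?_⟩, fun x hx => ?_⟩
  · have hnhds : Metric.ball (0 : Rn n) ρ ∈ 𝓝ˢ (Metric.closedBall (0 : Rn n) R₀) :=
      Metric.isOpen_ball.mem_nhdsSet.2 (Metric.closedBall_subset_ball hRρ)
    filter_upwards [hnhds] with x hx
    exact b.one_of_mem_closedBall (Metric.ball_subset_closedBall hx)
  · exact b.one_of_mem_closedBall (Metric.closedBall_subset_closedBall hrρ (hr hx))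

theorem eq_one_of_mem_closedBall (χ : Cutoff n R₀) {x : Rn n}
    (hx : x ∈ Metric.closedBall (0 : Rn n) R₀) : χ.toFun x = 1 :=
  χ.eq_one.self_of_nhdsSet x hx

end Cutoff

/-! ### Lower bound from one approximate eigenfunction -/

theorem inv_le_norm_of_apply_eq {E : Type*} [NormedAddCommGroup E] [NormedSpace ℂ E]
    {T : E →L[ℂ] E} {f u : E} {d : ℝ} (hT : T f = u) (hu : ‖u‖ = 1) (hf : ‖f‖ < d) :
    ENNReal.ofReal d⁻¹ ≤ ‖T‖ₑ := by
  have hd : 0 < d := (norm_nonneg f).trans_lt hf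
  rw [← ofReal_norm]
  refine ENNReal.ofReal_le_ofReal ((inv_le_iff_one_le_mul₀ hd).2 ?_)
  calc 1 = ‖T f‖ := by rw [hT, hu]
    _ ≤ ‖T‖ * ‖f‖ := T.le_opNorm f
    _ ≤ ‖T‖ * d := mul_le_mul_of_nonneg_left hf.le (norm_nonneg _)

namespace BlackBox

variable {n : ℕ} {R₀ : ℝ} {H₀ : Type*} [NormedAddCommGroup H₀] [InnerProductSpace ℂ H₀]
  [CompleteSpace H₀]

/-- The identity `u = χ R(z) χ (P - z²) u`, which holds since `χ` fixes `u` and `(P - z²) u`. -/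
theorem cutoffResolvent_apply_sub (B : BlackBox n R₀ H₀) {K : Set (Rn n)} (hK : IsClosed K)
    {χ : Cutoff n R₀} (hχ : ∀ x ∈ K, χ.toFun x = 1) (u : B.P.domain)
    (hu : ExteriorSupportedIn K (u : Space n R₀ H₀).snd) {z : ℂ} (hre : 0 < z.re)
    (him : 0 < z.im) :
    B.cutoffResolvent χ z (B.P u - z ^ 2 • (u : Space n R₀ H₀)) = u := by
  have hχu : χ.mul H₀ (u : Space n R₀ H₀) = u := by
    refine χ.mul_eq_self ?_
    filter_upwards [hu] with x hx h1 using hx fun hxK => h1 (hχ x hxK)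
  have hχPu : χ.mul H₀ (B.P u) = B.P u := by
    refine χ.mul_eq_self ?_
    filter_upwards [ae_restrict_of_ae (B.apply_snd_ae_eq_zero hK u hu)] with x hx h1
    refine hx ⟨?_, fun hxK => h1 (hχ x hxK)⟩
    by_contra hxe
    refine h1 (χ.eq_one_of_mem_closedBall ?_)
    simpa [exterior] using hxe
  have hz : (z ^ 2).im ≠ 0 := by
    rw [sq, Complex.mul_im]
    positivity
  rw [cutoffResolvent, ContinuousLinearMap.comp_apply, ContinuousLinearMap.comp_apply, map_sub,
    map_smul, hχPu, hχu, resolvent_apply_sub B.selfAdjoint hz, hχu]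

/-- The limit `z → k` of `u = χ R(z) χ (P - z²) u`, in norm. -/
theorem inv_le_cutoffResolventNorm (B : BlackBox n R₀ H₀) {K : Set (Rn n)} (hK : IsClosed K)
    {χ : Cutoff n R₀} (hχ : ∀ x ∈ K, χ.toFun x = 1) (u : B.P.domain)
    (hu : ExteriorSupportedIn K (u : Space n R₀ H₀).snd) (hu1 : ‖(u : Space n R₀ H₀)‖ = 1)
    {k d : ℝ} (hk : 0 < k) (hd : ‖B.P u - (k : ℂ) ^ 2 • (u : Space n R₀ H₀)‖ < d) :
    ENNReal.ofReal d⁻¹ ≤ B.cutoffResolventNorm χ k := by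
  have hcont : ContinuousAt (fun z : ℂ => B.P u - z ^ 2 • (u : Space n R₀ H₀)) (k : ℂ) := by
    fun_prop
  have hre : ∀ᶠ z : ℂ in 𝓝[{z : ℂ | 0 < z.im}] (k : ℂ), 0 < z.re :=
    nhdsWithin_le_nhds ((isOpen_lt continuous_const Complex.continuous_re).mem_nhds (by simpa))
  have him : ∀ᶠ z : ℂ in 𝓝[{z : ℂ | 0 < z.im}] (k : ℂ), 0 < z.im := eventually_mem_nhdsWithin
  rw [cutoffResolventNorm]
  split_ifs with h
  · obtain ⟨hmer, heq⟩ := h.choose_spec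
    set F := h.choose
    have hmk : MeromorphicAt F (k : ℂ) := hmer _ (by simpa using hk)
    rw [meromorphicNorm]
    split_ifs with hpole
    · exact le_top
    have hG : ContinuousAt (toMeromorphicNFAt F k) (k : ℂ) :=
      (hmk.meromorphicOrderAt_nonneg_iff_analyticAt_toMeromorphicNFAt.1
        (not_lt.1 hpole)).continuousAt
    have hlim := (hG.clm_apply hcont).mono_left
      (nhdsWithin_le_nhds (s := {z : ℂ | 0 < z.im}))
    have hev : ∀ᶠ z : ℂ in 𝓝[{z : ℂ | 0 < z.im}] (k : ℂ),
        (toMeromorphicNFAt F k z) (B.P u - z ^ 2 • (u : Space n R₀ H₀)) = u := by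
      filter_upwards [hre, him] with z hz1 hz2
      have hne : z ≠ k := fun hzk => by simp [hzk] at hz2
      rw [← hmk.eqOn_compl_singleton_toMeromorphicNFAt hne, heq z hz1 hz2]
      exact B.cutoffResolvent_apply_sub hK hχ u hu hz1 hz2
    have hbot : (𝓝[{z : ℂ | 0 < z.im}] (k : ℂ)).NeBot := by
      rw [← mem_closure_iff_nhdsWithin_neBot, Complex.closure_setOfPred_lt_im]
      simp
    have hlim' := tendsto_nhds_unique (hlim.congr' hev) tendsto_const_nhds
    exact inv_le_norm_of_apply_eq hlim' hu1 hd
  · refine le_liminf_of_le (by isBoundedDefault) ?_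
    have hlt : ∀ᶠ z : ℂ in 𝓝[{z : ℂ | 0 < z.im}] (k : ℂ),
        ‖B.P u - z ^ 2 • (u : Space n R₀ H₀)‖ < d :=
      nhdsWithin_le_nhds (hcont.norm.eventually_lt_const hd)
    filter_upwards [hre, him, hlt] with z hz1 hz2 hz3
    exact inv_le_norm_of_apply_eq (B.cutoffResolvent_apply_sub hK hχ u hu hz1 hz2) hu1 hz3

/-- A single element of the domain supported in `K` bounds the resolvent from below uniformly on
bounded sets of frequencies. -/
theorem exists_le_cutoffResolventNorm_of_le (B : BlackBox n R₀ H₀) {K : Set (Rn n)}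
    (hK : IsClosed K) {χ : Cutoff n R₀} (hχ : ∀ x ∈ K, χ.toFun x = 1) {μ δ : ℝ}
    (hq : B.HasQuasimode K μ δ) (k₁ : ℝ) :
    ∃ c : ℝ, 0 < c ∧ ∀ k : ℝ, 0 < k → k ≤ k₁ → ENNReal.ofReal c ≤ B.cutoffResolventNorm χ k := by
  obtain ⟨u, hu1, hu, -⟩ := hq
  refine ⟨(‖B.P u‖ + k₁ ^ 2 + 1)⁻¹, by positivity, fun k hk hk1 => ?_⟩
  refine B.inv_le_cutoffResolventNorm hK hχ u hu hu1 hk ?_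
  calc ‖B.P u - (k : ℂ) ^ 2 • (u : Space n R₀ H₀)‖
      ≤ ‖B.P u‖ + ‖(k : ℂ) ^ 2 • (u : Space n R₀ H₀)‖ := norm_sub_le _ _
    _ = ‖B.P u‖ + k ^ 2 := by
        rw [norm_smul, hu1, norm_pow, Complex.norm_real, Real.norm_eq_abs, sq_abs, mul_one]
    _ < ‖B.P u‖ + k₁ ^ 2 + 1 := by
        linarith [pow_le_pow_left₀ hk.le hk1 2]

/-! ### Lower bound from a family of quasimodes -/

theorem rpow_le_of_half_le_of_le_two_mul {k μ : ℝ} (hk : 0 < k) (h1 : k / 2 ≤ μ) (h2 : μ ≤ 2 * k)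
    (p : ℝ) : μ ^ p ≤ (2 ^ p + 2⁻¹ ^ p) * k ^ p := by
  have hμ : 0 < μ := (half_pos hk).trans_le h1
  have e1 : (2 * k) ^ p = 2 ^ p * k ^ p := Real.mul_rpow two_pos.le hk.le
  have e2 : (k / 2) ^ p = 2⁻¹ ^ p * k ^ p := by
    rw [div_eq_inv_mul, Real.mul_rpow (by positivity) hk.le]
  have p1 : 0 < (2 * k) ^ p := by positivity
  have p2 : 0 < (k / 2) ^ p := by positivity
  rw [add_mul, ← e1, ← e2]
  rcases le_total 0 p with hp | hp
  · linarith [Real.rpow_le_rpow hμ.le h2 hp]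
  · linarith [Real.rpow_le_rpow_of_nonpos (half_pos hk) h1 hp]

theorem exists_le_cutoffResolventNorm_of_ge (B : BlackBox n R₀ H₀) {K : Set (Rn n)}
    (hK : IsClosed K) {χ : Cutoff n R₀} (hχ : ∀ x ∈ K, χ.toFun x = 1) {s C₀ C₁ : ℝ} (hs : 0 ≤ s)
    (hC₀ : 0 < C₀) (hC₁ : 0 < C₁)
    (hq : ∀ k : ℝ, 0 < k → ∃ μ : ℝ, 0 < μ ∧ |μ - k| < C₁ * k ^ (-s) ∧
      B.HasQuasimode K μ (C₀ * μ ^ (-(s - 1)))) :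
    ∃ c : ℝ, 0 < c ∧ ∃ k₁ : ℝ, 0 < k₁ ∧ ∀ k : ℝ, k₁ ≤ k →
      ENNReal.ofReal (c * k ^ (s - 1)) ≤ B.cutoffResolventNorm χ k := by
  set M : ℝ := 2 ^ (-(s - 1)) + 2⁻¹ ^ (-(s - 1)) with hM
  have hM0 : 0 < M := by positivity
  refine ⟨(C₀ * M + 3 * C₁ + 1)⁻¹, by positivity, max 1 (2 * C₁), by positivity, fun k hk => ?_⟩
  have hk1 : 1 ≤ k := (le_max_left _ _).trans hk
  have hkC : 2 * C₁ ≤ k := (le_max_right _ _).trans hk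
  have hk0 : 0 < k := one_pos.trans_le hk1
  obtain ⟨μ, hμ, hμk, u, hu1, hu, hPu⟩ := hq k hk0
  -- Since `s ≥ 0`, the spacing is at most `C₁ ≤ k / 2`, so `μ` is comparable to `k`.
  have hks : k ^ (-s) ≤ 1 := Real.rpow_le_one_of_one_le_of_nonpos hk1 (by linarith)
  have hdist : |μ - k| < k / 2 := by
    have : C₁ * k ^ (-s) ≤ C₁ * 1 := mul_le_mul_of_nonneg_left hks hC₁.le
    linarith
  obtain ⟨hlo, hhi⟩ := abs_lt.1 hdist
  have hkp : k ^ (-(s - 1)) = k ^ (-s) * k := by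
    rw [show -(s - 1) = -s + 1 by ring, Real.rpow_add hk0, Real.rpow_one]
  have hkp0 : 0 < k ^ (-(s - 1)) := by positivity
  have hres : C₀ * μ ^ (-(s - 1)) ≤ C₀ * M * k ^ (-(s - 1)) := by
    rw [mul_assoc]
    exact mul_le_mul_of_nonneg_left
      (rpow_le_of_half_le_of_le_two_mul hk0 (by linarith) (by linarith) _) hC₀.le
  have hsq : |μ ^ 2 - k ^ 2| ≤ 3 * C₁ * k ^ (-(s - 1)) := by
    rw [show μ ^ 2 - k ^ 2 = (μ - k) * (μ + k) by ring, abs_mul, abs_of_pos (add_pos hμ hk0), hkp]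
    calc |μ - k| * (μ + k) ≤ (C₁ * k ^ (-s)) * (3 * k) :=
          mul_le_mul hμk.le (by linarith) (by linarith) (by positivity)
      _ = 3 * C₁ * (k ^ (-s) * k) := by ring
  have hlt : ‖B.P u - (k : ℂ) ^ 2 • (u : Space n R₀ H₀)‖
      < (C₀ * M + 3 * C₁ + 1) * k ^ (-(s - 1)) := by
    have hsplit : B.P u - (k : ℂ) ^ 2 • (u : Space n R₀ H₀)
        = (B.P u - (μ : ℂ) ^ 2 • (u : Space n R₀ H₀))
          + ((μ ^ 2 - k ^ 2 : ℝ) : ℂ) • (u : Space n R₀ H₀) := by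
      push_cast
      rw [sub_smul]
      abel
    have hn : ‖((μ ^ 2 - k ^ 2 : ℝ) : ℂ) • (u : Space n R₀ H₀)‖ = |μ ^ 2 - k ^ 2| := by
      rw [norm_smul, hu1, mul_one, Complex.norm_real, Real.norm_eq_abs]
    rw [hsplit]
    refine (norm_add_le _ _).trans_lt ?_
    rw [hn]
    linarith
  have h := B.inv_le_cutoffResolventNorm hK hχ u hu hu1 hk0 hlt
  rwa [mul_inv, ← Real.rpow_neg hk0.le, neg_neg] at h

end BlackBox

/-- A lower bound `c k ^ p` beyond `k₁` and a constant lower bound up to `k₁` combine on any set of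
frequencies on which `k ^ p` is bounded up to `k₁`. -/
theorem exists_mul_rpow_le_of_le_of_ge {N : ℝ → ℝ≥0∞} {S : Set ℝ} (hS : ∀ k ∈ S, 0 < k)
    {p c c' k₁ A : ℝ} (hc : 0 < c) (hc' : 0 < c') (hA : 0 < A)
    (hge : ∀ k, k₁ ≤ k → ENNReal.ofReal (c * k ^ p) ≤ N k)
    (hle : ∀ k, 0 < k → k ≤ k₁ → ENNReal.ofReal c' ≤ N k)
    (hSA : ∀ k ∈ S, k ≤ k₁ → k ^ p ≤ A) :
    ∃ C : ℝ, 0 < C ∧ ∀ k ∈ S, ENNReal.ofReal (C * k ^ p) ≤ N k := by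
  refine ⟨min c (c' / A), lt_min hc (div_pos hc' hA), fun k hkS => ?_⟩
  have hk := hS k hkS
  have hkp : 0 ≤ k ^ p := Real.rpow_nonneg hk.le p
  rcases le_total k₁ k with h | h
  · refine (ENNReal.ofReal_le_ofReal ?_).trans (hge k h)
    exact mul_le_mul_of_nonneg_right (min_le_left _ _) hkp
  · refine (ENNReal.ofReal_le_ofReal ?_).trans (hle k hk h)
    calc min c (c' / A) * k ^ p ≤ c' / A * A :=
          mul_le_mul (min_le_right _ _) (hSA k hkS h) hkp (div_pos hc' hA).le
      _ = c' := div_mul_cancel₀ _ hA.ne'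

end BlackBoxScattering

theorem mainTheorem12 {n : ℕ} {R₀ : ℝ} {H₀ : Type*} [NormedAddCommGroup H₀]
    [InnerProductSpace ℂ H₀] [CompleteSpace H₀] (B : BlackBoxScattering.BlackBox n R₀ H₀)
    (K : Set (BlackBoxScattering.Rn n)) (hK : IsCompact K) (s : ℝ) (hs : 0 ≤ s)
    (hquasi : ∃ C₀ > 0, ∃ C₁ > 0, ∀ k : ℝ, 0 < k → ∀ l ∈ Set.Icc k (k + 1),
      ∃ μ : ℝ, 0 < μ ∧ |μ - l| < C₁ * k ^ (-s) ∧
        B.HasQuasimode K μ (C₀ * μ ^ (-(s - 1)))) :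
    ∃ χ : BlackBoxScattering.Cutoff n R₀,
      (∀ k₀ : ℝ, 0 < k₀ → ∃ C₂ : ℝ, 0 < C₂ ∧ ∀ k : ℝ, k₀ ≤ k →
        ENNReal.ofReal (C₂ * k ^ (s - 1)) ≤ B.cutoffResolventNorm χ k) ∧
      (1 ≤ s → ∃ C₂ : ℝ, 0 < C₂ ∧ ∀ k : ℝ, 0 < k →
        ENNReal.ofReal (C₂ * k ^ (s - 1)) ≤ B.cutoffResolventNorm χ k) := by
  obtain ⟨C₀, hC₀, C₁, hC₁, hq⟩ := hquasi
  obtain ⟨χ, hχ⟩ := BlackBoxScattering.Cutoff.exists_eq_one_on R₀ hK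
  have hq' := fun (k : ℝ) (hk : 0 < k) => hq k hk k ⟨le_rfl, by linarith⟩
  obtain ⟨c, hc, k₁, hk₁, hge⟩ :=
    B.exists_le_cutoffResolventNorm_of_ge hK.isClosed hχ hs hC₀ hC₁ hq'
  obtain ⟨μ, -, -, hμ⟩ := hq' 1 one_pos
  obtain ⟨c', hc', hle⟩ := B.exists_le_cutoffResolventNorm_of_le hK.isClosed hχ hμ k₁
  refine ⟨χ, fun k₀ hk₀ => ?_, fun hs1 => ?_⟩
  · refine BlackBoxScattering.exists_mul_rpow_le_of_le_of_ge (S := Ici k₀)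
      (A := k₀ ^ (s - 1) + k₁ ^ (s - 1)) (fun k hk => hk₀.trans_le hk) hc hc' (by positivity)
      hge hle fun k hk hkk₁ => ?_
    have h0 : 0 < k₀ ^ (s - 1) := by positivity
    have h1 : 0 < k₁ ^ (s - 1) := by positivity
    rcases le_total 0 (s - 1) with hp | hp
    · linarith [Real.rpow_le_rpow (hk₀.le.trans hk) hkk₁ hp]
    · linarith [Real.rpow_le_rpow_of_nonpos hk₀ hk hp]
  · exact BlackBoxScattering.exists_mul_rpow_le_of_le_of_ge (S := Ioi 0) (A := k₁ ^ (s - 1))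
      (fun k hk => hk) hc hc' (by positivity) hge hle
      fun k hk hkk₁ => Real.rpow_le_rpow (le_of_lt hk) hkk₁ (by linarith)
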